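/- Let $d,m\in\mathbb N$. Let $q_{hk}\in C^1(\mathbb R^d;\mathbb R)$, let $A^{hk}=(a^{hk}_{ij})$ be real $m\times m$ matrix-valued functions with $a^{hk}_{ij}\in C^1(\mathbb R^d)$ ($h,k=1,\dots,d$, $i,j=1,\dots,m$), and let $V=(v_{ij})$ be a real $m\times m$ matrix-valued function with $v_{ij}\in L^\infty_{\rm loc}(\mathbb R^d)$. Put $Q=(q_{hk})$, $Q^{hk}=q_{hk}I+A^{hk}$ and $$\mathcal A u=\sum_{h,k=1}^d D_h(Q^{hk}D_ku)-Vu .$$ Write $(a,b)=\sum_i a_i\overline{b_i}$. Assume that there are constants $c_0>0$ and $\mathscr C>0$ such that, for all $x\in\mathbb R^d$, all $\theta^1,\dots,\theta^d\in\mathbb C^m$, all $\zeta\in\mathbb C^d$ and all $\xi\in\mathbb C^m$: * $\mathrm{Re}\,(Q(x)\zeta,\zeta)>0$ if $\zeta\ne0$, and $|\mathrm{Im}\,(Q(x)\zeta,\zeta)|\le c_0\,\mathrm{Re}\,(Q(x)\zeta,\zeta)$; * $0\le \mathrm{Re}\sum_{h,k=1}^d(A^{hk}(x)\theta^k,\theta^h)\le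 \mathscr C\,\mathrm{Re}\sum_{i=1}^m\sum_{h,k=1}^d q_{hk}(x)\theta^k_i\overline{\theta^h_i}$; * $\big|\mathrm{Im}\sum_{h,k=1}^d(A^{hk}(x)\theta^k,\theta^h)\big|\le \mathscr C\,\mathrm{Re}\sum_{i=1}^m\sum_{h,k=1}^d q_{hk}(x)\theta^k_i\overline{\theta^h_i}$; * $\mathrm{Re}\,(V(x)\xi,\xi)\ge0$. Assume moreover that there are a function $v\in C^1(\mathbb R^d;\mathbb R)$ with $v_0:=\inf_{\mathbb R^d}v>0$ and constants $\gamma,C_\gamma>0$ such that, for all $x\in\mathbb R^d$ and $\xi\in\mathbb R^m$, $$(Q(x)\nabla v(x),\nabla v(x))^{1/2}\le\gamma\, v(x)^{3/2}+C_\gamma,\qquad (V(x)\xi,\xi)\ge v(x)|\xi|^2 .$$ Finally assume that $\mathscr C<\tfrac12$, that $p\in\left(1+\frac{6\mathscr C}{4\mathscr C+1},\ \frac32+\frac1{4\mathscr C}\right)$, and that $$\Lambda_p:=1-\frac{(p-1)^2(\gamma v_0^{3/2}+C_\gamma)^2(1+c_0+2\mathscr C)^2}{4v_0^3\,\Theta_{p,\mathscr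 C}}>0,\qquad \Theta_{p,\mathscr C}=\begin{cases}p-1-2\mathscr C(5-2p),&p<2,\\ 1-2\mathscr C(2p-3),&p\ge2.\end{cases}$$ Then there exists a constant $K>0$ such that $$\|vu\|_{L^p(\mathbb R^d;\mathbb C^m)}\le K\,\|\mathcal A u\|_{L^p(\mathbb R^d;\mathbb C^m)}\qquad\text{for all }u\in C_c^\infty(\mathbb R^d;\mathbb C^m).$$ -/

import Mathlib

open scoped ContDiff

noncomputable section

namespace EllipticSystem

/-- The pairing `(a, b) = ∑ᵢ aᵢ * conj bᵢ` on `𝕜ⁿ`, linear in the first argument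
(Mathlib's `inner` is linear in the second one). -/
def pair {𝕜 : Type*} [RCLike 𝕜] {n : ℕ} (a b : EuclideanSpace 𝕜 (Fin n)) : 𝕜 :=
  inner 𝕜 b a

/-- A real `n × n` matrix acting on a vector of `𝕜ⁿ`, `𝕜 = ℝ` or `ℂ`. -/
def act {𝕜 : Type*} [RCLike 𝕜] {n : ℕ} (M : Matrix (Fin n) (Fin n) ℝ)
    (w : EuclideanSpace 𝕜 (Fin n)) : EuclideanSpace 𝕜 (Fin n) :=
  WithLp.toLp 2 fun i => ∑ j, ((M i j : ℝ) : 𝕜) * w j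

/-- The partial derivative `D_h f` of a vector-valued function on `ℝᵈ`. -/
def partialD {d : ℕ} {F : Type*} [NormedAddCommGroup F] [NormedSpace ℝ F]
    (h : Fin d) (f : EuclideanSpace ℝ (Fin d) → F) (x : EuclideanSpace ℝ (Fin d)) : F :=
  fderiv ℝ f x (EuclideanSpace.single h (1 : ℝ))

/-- The real coefficients of the operator `∑_{h,k} D_h (Q^{hk} D_k ·) - V`, where
`Q^{hk} = q_{hk} I + A^{hk}`; this structure holds data only. -/
structure Coefficients (d m : ℕ) where
  q : Fin d → Fin d → EuclideanSpace ℝ (Fin d) → ℝ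
  A : Fin d → Fin d → EuclideanSpace ℝ (Fin d) → Matrix (Fin m) (Fin m) ℝ
  V : EuclideanSpace ℝ (Fin d) → Matrix (Fin m) (Fin m) ℝ

namespace Coefficients

variable {d m : ℕ} (L : Coefficients d m)

/-- The `d × d` matrix `Q(x) = (q_{hk}(x))`. -/
def Q (x : EuclideanSpace ℝ (Fin d)) : Matrix (Fin d) (Fin d) ℝ :=
  Matrix.of fun h k => L.q h k x

/-- The `m × m` matrix `Q^{hk}(x) = q_{hk}(x) I + A^{hk}(x)`. -/
def block (h k : Fin d) (x : EuclideanSpace ℝ (Fin d)) : Matrix (Fin m) (Fin m) ℝ :=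
  L.q h k x • (1 : Matrix (Fin m) (Fin m) ℝ) + L.A h k x

/-- The operator `u ↦ ∑_{h,k} D_h (Q^{hk} D_k u) - V u`. -/
def op (u : EuclideanSpace ℝ (Fin d) → EuclideanSpace ℂ (Fin m))
    (x : EuclideanSpace ℝ (Fin d)) : EuclideanSpace ℂ (Fin m) :=
  (∑ h, ∑ k, partialD h (fun y => act (L.block h k y) (partialD k u y)) x) - act (L.V x) (u x)

/-- `∑_{h,k} (A^{hk}(x) θ^k, θ^h)`. -/
def formA (x : EuclideanSpace ℝ (Fin d)) (θ : Fin d → EuclideanSpace ℂ (Fin m)) : ℂ :=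
  ∑ h, ∑ k, pair (act (L.A h k x) (θ k)) (θ h)

/-- `∑_i ∑_{h,k} q_{hk}(x) θ^k_i conj (θ^h_i)`. -/
def formQ (x : EuclideanSpace ℝ (Fin d)) (θ : Fin d → EuclideanSpace ℂ (Fin m)) : ℂ :=
  ∑ i, ∑ h, ∑ k, (L.q h k x : ℂ) * θ k i * starRingEnd ℂ (θ h i)

/-- The standing hypotheses on the coefficients, with the constants `c₀` and `C`. -/
structure Standing (c₀ C : ℝ) : Prop where
  q_contDiff : ∀ h k, ContDiff ℝ 1 (L.q h k)
  Q_pos : ∀ (x : EuclideanSpace ℝ (Fin d)) (ξ : EuclideanSpace ℂ (Fin d)), ξ ≠ 0 →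
    0 < (pair (act (L.Q x) ξ) ξ).re
  c₀_pos : 0 < c₀
  Q_im_le : ∀ (x : EuclideanSpace ℝ (Fin d)) (ξ : EuclideanSpace ℂ (Fin d)),
    |(pair (act (L.Q x) ξ) ξ).im| ≤ c₀ * (pair (act (L.Q x) ξ) ξ).re
  A_contDiff : ∀ h k i j, ContDiff ℝ 1 fun x => L.A h k x i j
  C_pos : 0 < C
  A_re_nonneg : ∀ x θ, 0 ≤ (L.formA x θ).re
  A_re_le : ∀ x θ, (L.formA x θ).re ≤ C * (L.formQ x θ).re
  A_im_le : ∀ x θ, |(L.formA x θ).im| ≤ C * (L.formQ x θ).re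
  /-- The entries of `V` belong to `L^∞_loc(ℝᵈ)`. -/
  V_locBounded : ∀ i j, ∀ K : Set (EuclideanSpace ℝ (Fin d)), IsCompact K →
    MeasureTheory.MemLp (fun x => L.V x i j) ⊤ (MeasureTheory.volume.restrict K)
  V_re_nonneg : ∀ (x : EuclideanSpace ℝ (Fin d)) (ξ : EuclideanSpace ℂ (Fin m)),
    0 ≤ (pair (act (L.V x) ξ) ξ).re

end Coefficients

/-- The constant `Θ_{p,C}`. -/
def Theta (p C : ℝ) : ℝ :=
  if p < 2 then p - 1 - 2 * C * (5 - 2 * p) else 1 - 2 * C * (2 * p - 3)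

/-- The constant `Λ_p`. -/
def Lambda (p C c₀ γ Cγ v₀ : ℝ) : ℝ :=
  1 - (p - 1) ^ 2 * (γ * v₀ ^ (3 / 2 : ℝ) + Cγ) ^ 2 * (1 + c₀ + 2 * C) ^ 2
    / (4 * v₀ ^ 3 * Theta p C)

end EllipticSystem

end

/-! Test `L.op u` against `v^(p-1) (|u|² + ε)^((p-2)/2) u`. The regularization by `ε` keeps this
`C¹` where `u` vanishes, for every `p > 1`. Up to the weight, its `h`-th derivative is `D_h u +
((p-1)/v · D_h v + (p-2) s Re(D_h u, u)) u` with `s = (|u|² + ε)⁻¹`, so that `s |u|² ≤ 1`. After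
integration by parts the matter is pointwise and algebraic, in `θ = (D_h u)_h` and `z = u`.

Write `N` for the scalar energy of `θ`. The `D_h u` and radial terms together give at least `Θ N`
(`Theta_mul_le`); polarization and a discriminant bound the term with `∇v` (`sq_re_blockForm_le`).
Since `(Q∇v, ∇v) ≤ κ² v³`, AM-GM absorbs that term into `Θ N` plus a fraction `1 - Λ_p` of `v |z|²`,
while `V` supplies all of `v |z|²` (`pointwise_bound`).

What remains is `Λ_p ∫ v |u|² w ≤ ∫ |L.op u| |u| w`, with `w` the weight (`integral_weight_le`). As
`ε → 0` this becomes `Λ_p ∫ (v|u|)^p ≤ ∫ |L.op u| (v|u|)^(p-1)`, and Hölder gives the estimate with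
`K = 1/Λ_p` (`eLpNorm_smul_le`). -/

namespace EllipticSystem

/-! ### Algebra of the pairing and of the matrix action. -/

section Pairing

variable {𝕜 : Type*} [RCLike 𝕜] {n : ℕ}

lemma pair_eq_sum (a b : EuclideanSpace 𝕜 (Fin n)) :
    pair a b = ∑ i, a i * starRingEnd 𝕜 (b i) := by
  simp [pair, PiLp.inner_apply, RCLike.inner_apply]

lemma act_apply (M : Matrix (Fin n) (Fin n) ℝ) (w : EuclideanSpace 𝕜 (Fin n)) (i : Fin n) :
    act M w i = ∑ j, ((M i j : ℝ) : 𝕜) * w j := rfl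

lemma pair_act_self_real (M : Matrix (Fin n) (Fin n) ℝ) (g : EuclideanSpace ℝ (Fin n)) :
    pair (act M g) g = ∑ i, ∑ j, M i j * g j * g i := by
  rw [pair_eq_sum]
  simp [act_apply, Finset.sum_mul]

lemma act_add (M : Matrix (Fin n) (Fin n) ℝ) (w z : EuclideanSpace 𝕜 (Fin n)) :
    act M (w + z) = act M w + act M z := by
  ext i
  simp [act_apply, mul_add, Finset.sum_add_distrib]

lemma act_smul (M : Matrix (Fin n) (Fin n) ℝ) (c : 𝕜) (w : EuclideanSpace 𝕜 (Fin n)) :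
    act M (c • w) = c • act M w := by
  ext i
  simp only [act_apply, PiLp.smul_apply, smul_eq_mul, Finset.mul_sum]
  exact Finset.sum_congr rfl fun j _ => by ring

lemma add_act (M M' : Matrix (Fin n) (Fin n) ℝ) (w : EuclideanSpace 𝕜 (Fin n)) :
    act (M + M') w = act M w + act M' w := by
  ext i
  simp [act_apply, add_mul, Finset.sum_add_distrib]

lemma smul_one_act (c : ℝ) (w : EuclideanSpace 𝕜 (Fin n)) :
    act (c • (1 : Matrix (Fin n) (Fin n) ℝ)) w = (c : 𝕜) • w := by
  ext i
  simp [act_apply, Matrix.one_apply, Finset.sum_ite_eq, apply_ite (RCLike.ofReal (K := 𝕜)), ite_mul,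
    RCLike.real_smul_eq_coe_mul]

end Pairing

/-! ### Off-diagonal bounds for sesquilinear forms. -/

section Sesquilinear

variable {W : Type*} [AddCommGroup W] [Module ℂ W]

/-- Polarization: bounds on the real and imaginary parts of a sesquilinear form on the diagonal
bound the real part of the form off the diagonal. -/
lemma abs_re_le_of_diagonal (B N : W →ₗ[ℂ] W →ₗ⋆[ℂ] ℂ) {α β : ℝ}
    (hre : ∀ θ, |(B θ θ).re| ≤ α * (N θ θ).re) (him : ∀ θ, |(B θ θ).im| ≤ β * (N θ θ).re)
    (θ ψ : W) :
    |(B θ ψ).re| ≤ (α + β) / 2 * ((N θ θ).re + (N ψ ψ).re) := by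
  have h1 := abs_le.1 (hre (θ + ψ))
  have h2 := abs_le.1 (hre (θ - ψ))
  -- `B` need not be Hermitian: real parts at `θ ± ψ` control only `Re (B θ ψ + B ψ θ)`. Imaginary
  -- parts at `θ ± iψ` control `Re (B ψ θ - B θ ψ)`, and the difference isolates `B θ ψ`.
  have h3 := abs_le.1 (him (θ + Complex.I • ψ))
  have h4 := abs_le.1 (him (θ - Complex.I • ψ))
  simp only [map_add, map_sub, LinearMap.add_apply, LinearMap.sub_apply, map_smul,
    LinearMap.map_smulₛₗ, LinearMap.smul_apply, smul_eq_mul, Complex.add_re, Complex.sub_re,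
    Complex.add_im, Complex.sub_im, Complex.mul_re, Complex.mul_im, Complex.I_re, Complex.I_im,
    Complex.conj_I, Complex.neg_re, Complex.neg_im] at h1 h2 h3 h4
  rw [abs_le]
  constructor <;> nlinarith

/-- Replacing `θ` by `t θ` in the additive bound gives a quadratic in `t` that is nonnegative on
`ℝ`; its discriminant yields the product form, a Cauchy–Schwarz inequality. -/
lemma sq_re_le_of_diagonal (B N : W →ₗ[ℂ] W →ₗ⋆[ℂ] ℂ) {α β : ℝ}
    (hre : ∀ θ, |(B θ θ).re| ≤ α * (N θ θ).re) (him : ∀ θ, |(B θ θ).im| ≤ β * (N θ θ).re)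
    (θ ψ : W) :
    (B θ ψ).re ^ 2 ≤ (α + β) ^ 2 * ((N θ θ).re * (N ψ ψ).re) := by
  have key : ∀ t : ℝ, 0 ≤ (α + β) / 2 * (N θ θ).re * (t * t) + (B θ ψ).re * t
      + (α + β) / 2 * (N ψ ψ).re := by
    intro t
    have h := (abs_le.1 (abs_re_le_of_diagonal B N hre him ((t : ℂ) • θ) ψ)).1
    simp only [map_smul, LinearMap.map_smulₛₗ, LinearMap.smul_apply, smul_eq_mul,
      Complex.conj_ofReal, Complex.re_ofReal_mul] at h
    nlinarith
  have := discrim_le_zero key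
  rw [discrim] at this
  nlinarith

end Sesquilinear

/-! ### Pointwise coercivity of the system. -/

section Forms

variable {d m : ℕ}

/-- The sesquilinear form `(θ, ψ) ↦ ∑_{h,k} (M^{hk} θ^k, ψ^h)`. -/
noncomputable def blockForm (M : Fin d → Fin d → Matrix (Fin m) (Fin m) ℝ) :
    (Fin d → EuclideanSpace ℂ (Fin m)) →ₗ[ℂ] (Fin d → EuclideanSpace ℂ (Fin m)) →ₗ⋆[ℂ] ℂ :=
  LinearMap.mk₂'ₛₗ (RingHom.id ℂ) (starRingEnd ℂ)
    (fun θ ψ => ∑ h, ∑ k, pair (act (M h k) (θ k)) (ψ h))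
    (fun θ θ' ψ => by simp [act_add, pair, inner_add_right, Finset.sum_add_distrib])
    (fun c θ ψ => by simp [act_smul, pair, inner_smul_right, Finset.mul_sum])
    (fun θ ψ ψ' => by simp [pair, inner_add_left, Finset.sum_add_distrib])
    (fun c θ ψ => by simp [pair, inner_smul_left, Finset.mul_sum])

lemma blockForm_apply (M : Fin d → Fin d → Matrix (Fin m) (Fin m) ℝ)
    (θ ψ : Fin d → EuclideanSpace ℂ (Fin m)) :
    blockForm M θ ψ = ∑ h, ∑ k, pair (act (M h k) (θ k)) (ψ h) := rfl

lemma blockForm_add (M M' : Fin d → Fin d → Matrix (Fin m) (Fin m) ℝ)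
    (θ ψ : Fin d → EuclideanSpace ℂ (Fin m)) :
    blockForm (fun h k => M h k + M' h k) θ ψ = blockForm M θ ψ + blockForm M' θ ψ := by
  simp [blockForm_apply, add_act, pair, inner_add_right, Finset.sum_add_distrib]

lemma blockForm_scalar (q : Fin d → Fin d → ℝ) (θ ψ : Fin d → EuclideanSpace ℂ (Fin m)) :
    blockForm (fun h k => q h k • (1 : Matrix (Fin m) (Fin m) ℝ)) θ ψ
      = ∑ h, ∑ k, (q h k : ℂ) * pair (θ k) (ψ h) := by
  simp only [blockForm_apply, smul_one_act, pair, inner_smul_right]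
  rfl

/-- The real part of a real matrix form on a complex vector splits into the forms of the real and
imaginary parts of the vector. -/
lemma re_pair_act_eq {n : ℕ} (M : Matrix (Fin n) (Fin n) ℝ) (w : EuclideanSpace ℂ (Fin n)) :
    (pair (act M w) w).re =
      pair (act M (WithLp.toLp 2 fun i => (w i).re)) (WithLp.toLp 2 fun i => (w i).re)
      + pair (act M (WithLp.toLp 2 fun i => (w i).im)) (WithLp.toLp 2 fun i => (w i).im) := by
  simp only [pair_eq_sum, act_apply, Finset.sum_mul, Complex.re_sum, ← Finset.sum_add_distrib]
  refine Finset.sum_congr rfl fun i _ => Finset.sum_congr rfl fun j _ => ?_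
  simp

namespace Coefficients

variable (L : Coefficients d m) {c₀ C : ℝ}

/-- The sesquilinear form of the scalar principal part. -/
noncomputable abbrev scalarForm (x : EuclideanSpace ℝ (Fin d)) :=
  blockForm (m := m) fun h k => L.q h k x • (1 : Matrix (Fin m) (Fin m) ℝ)

lemma formQ_eq (x : EuclideanSpace ℝ (Fin d)) (θ : Fin d → EuclideanSpace ℂ (Fin m)) :
    L.formQ x θ = L.scalarForm x θ θ := by
  rw [scalarForm, blockForm_scalar, formQ, Finset.sum_comm]
  refine Finset.sum_congr rfl fun h _ => ?_
  rw [Finset.sum_comm]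
  simp [pair_eq_sum, Finset.mul_sum, mul_assoc]

lemma formA_eq (x : EuclideanSpace ℝ (Fin d)) (θ : Fin d → EuclideanSpace ℂ (Fin m)) :
    L.formA x θ = blockForm (fun h k => L.A h k x) θ θ := rfl

lemma formQ_eq_sum_pair (x : EuclideanSpace ℝ (Fin d)) (θ : Fin d → EuclideanSpace ℂ (Fin m)) :
    L.formQ x θ = ∑ i, pair (act (L.Q x) (WithLp.toLp 2 fun k => θ k i))
      (WithLp.toLp 2 fun k => θ k i) := by
  simp [formQ, pair_eq_sum, act_apply, Q, Finset.sum_mul]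

variable {L}

lemma Standing.Q_nonneg (hL : L.Standing c₀ C) (x : EuclideanSpace ℝ (Fin d))
    (ζ : EuclideanSpace ℂ (Fin d)) : 0 ≤ (pair (act (L.Q x) ζ) ζ).re := by
  by_cases h : ζ = 0
  · simp [h, pair]
  · exact (hL.Q_pos x ζ h).le

lemma Standing.scalarForm_nonneg (hL : L.Standing c₀ C) (x : EuclideanSpace ℝ (Fin d))
    (θ : Fin d → EuclideanSpace ℂ (Fin m)) : 0 ≤ (L.scalarForm x θ θ).re := by
  rw [← formQ_eq, formQ_eq_sum_pair, Complex.re_sum]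
  exact Finset.sum_nonneg fun i _ => hL.Q_nonneg x _

lemma Standing.abs_im_scalarForm_le (hL : L.Standing c₀ C) (x : EuclideanSpace ℝ (Fin d))
    (θ : Fin d → EuclideanSpace ℂ (Fin m)) :
    |(L.scalarForm x θ θ).im| ≤ c₀ * (L.scalarForm x θ θ).re := by
  rw [← formQ_eq, formQ_eq_sum_pair, Complex.re_sum, Complex.im_sum, Finset.mul_sum]
  exact (Finset.abs_sum_le_sum_abs _ _).trans (Finset.sum_le_sum fun i _ => hL.Q_im_le x _)

/-- The scalar form on `θ^h = g_h z` with `g` real. -/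
lemma re_scalarForm_smul_smul (x : EuclideanSpace ℝ (Fin d)) (g : EuclideanSpace ℝ (Fin d))
    (z : EuclideanSpace ℂ (Fin m)) :
    (L.scalarForm x (fun h => (g h : ℂ) • z) fun h => (g h : ℂ) • z).re
      = pair (act (L.Q x) g) g * ‖z‖ ^ 2 := by
  have h : L.scalarForm x (fun h => (g h : ℂ) • z) (fun h => (g h : ℂ) • z)
      = ((pair (act (L.Q x) g) g * ‖z‖ ^ 2 : ℝ) : ℂ) := by
    rw [scalarForm, blockForm_scalar]
    simp only [pair, inner_smul_left, inner_smul_right, inner_self_eq_norm_sq_to_K]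
    have := pair_eq_sum (act (L.Q x) g) g
    rw [pair] at this
    rw [this]
    simp [act_apply, Q, Finset.sum_mul]
    refine Finset.sum_congr rfl fun i _ => Finset.sum_congr rfl fun j _ => ?_
    ring
  rw [h, Complex.ofReal_re]

/-- Scalar coefficients pull out of the pairing with `z`, so only the numbers `Re(θ^h, z)` survive.
As `Q` need not be symmetric, the mirrored statement is needed too. -/
lemma re_scalarForm_right_smul (x : EuclideanSpace ℝ (Fin d))
    (θ : Fin d → EuclideanSpace ℂ (Fin m)) (z : EuclideanSpace ℂ (Fin m))
    (a : EuclideanSpace ℝ (Fin d)) (ha : ∀ h, a h = (pair (θ h) z).re) :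
    (L.scalarForm x θ fun h => (a h : ℂ) • z).re = pair (act (L.Q x) a) a := by
  rw [scalarForm, blockForm_scalar]
  rw [pair_act_self_real]
  simp only [Complex.re_sum]
  refine Finset.sum_congr rfl fun i _ => Finset.sum_congr rfl fun j _ => ?_
  rw [pair, inner_smul_left, ← pair]
  simp [ha, Q]
  ring

lemma re_scalarForm_left_smul (x : EuclideanSpace ℝ (Fin d))
    (θ : Fin d → EuclideanSpace ℂ (Fin m)) (z : EuclideanSpace ℂ (Fin m))
    (a : EuclideanSpace ℝ (Fin d)) (ha : ∀ h, a h = (pair (θ h) z).re) :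
    (L.scalarForm x (fun h => (a h : ℂ) • z) θ).re = pair (act (L.Q x) a) a := by
  rw [scalarForm, blockForm_scalar]
  rw [pair_act_self_real]
  simp only [Complex.re_sum]
  refine Finset.sum_congr rfl fun i _ => Finset.sum_congr rfl fun j _ => ?_
  rw [pair, inner_smul_right, ← inner_conj_symm, ← pair]
  simp [ha, Q, mul_assoc]

lemma Standing.pair_Q_nonneg (hL : L.Standing c₀ C) (x : EuclideanSpace ℝ (Fin d))
    (g : EuclideanSpace ℝ (Fin d)) : 0 ≤ pair (act (L.Q x) g) g := by
  have h := hL.Q_nonneg x (WithLp.toLp 2 fun i => (g i : ℂ))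
  rw [re_pair_act_eq] at h
  simpa [pair_eq_sum, act_apply] using h

/-- The sharp bound for the radial part of `θ`, with `s |z|² ≤ 1`. -/
lemma Standing.mul_pair_le_scalarForm (hL : L.Standing c₀ C) (x : EuclideanSpace ℝ (Fin d))
    (θ : Fin d → EuclideanSpace ℂ (Fin m)) (z : EuclideanSpace ℂ (Fin m))
    (a : EuclideanSpace ℝ (Fin d)) (ha : ∀ h, a h = (pair (θ h) z).re) {s : ℝ} (hs : 0 ≤ s)
    (hsz : s * ‖z‖ ^ 2 ≤ 1) :
    s * pair (act (L.Q x) a) a ≤ (L.scalarForm x θ θ).re := by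
  -- Positivity here expands to `N - 2s(Qa,a) + s²|z|²(Qa,a) ≥ 0`, and `s|z|² ≤ 1` merges the last
  -- two terms into at most `-s(Qa,a)`.
  have h := hL.scalarForm_nonneg x (θ - (s : ℂ) • fun h => (a h : ℂ) • z)
  have h1 := re_scalarForm_right_smul (L := L) x θ z a ha
  have h2 := re_scalarForm_left_smul (L := L) x θ z a ha
  have h3 := re_scalarForm_smul_smul (L := L) x a z
  simp only [map_sub, LinearMap.sub_apply, map_smul, LinearMap.map_smulₛₗ, LinearMap.smul_apply,
    smul_eq_mul, Complex.conj_ofReal, Complex.re_ofReal_mul, Complex.sub_re] at h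
  rw [h1, h2, h3] at h
  have h0 := hL.pair_Q_nonneg x a
  nlinarith [mul_nonneg (mul_nonneg hs h0) (sub_nonneg.2 hsz)]

lemma re_pair_V_ge (x : EuclideanSpace ℝ (Fin d)) {r : ℝ}
    (hV : ∀ ξ : EuclideanSpace ℝ (Fin m), r * ‖ξ‖ ^ 2 ≤ pair (act (L.V x) ξ) ξ)
    (z : EuclideanSpace ℂ (Fin m)) : r * ‖z‖ ^ 2 ≤ (pair (act (L.V x) z) z).re := by
  rw [re_pair_act_eq]
  refine le_trans (le_of_eq ?_) (add_le_add (hV _) (hV _))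
  rw [← mul_add]
  congr 1
  simp only [EuclideanSpace.norm_sq_eq, ← Finset.sum_add_distrib]
  refine Finset.sum_congr rfl fun i _ => ?_
  rw [Complex.sq_norm, Complex.normSq_apply]
  simp [sq]

lemma blockForm_block (x : EuclideanSpace ℝ (Fin d)) (θ ψ : Fin d → EuclideanSpace ℂ (Fin m)) :
    blockForm (fun h k => L.block h k x) θ ψ
      = L.scalarForm x θ ψ + blockForm (fun h k => L.A h k x) θ ψ :=
  blockForm_add _ _ θ ψ

lemma Standing.abs_re_blockForm_A_le (hL : L.Standing c₀ C) (x : EuclideanSpace ℝ (Fin d))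
    (ψ : Fin d → EuclideanSpace ℂ (Fin m)) :
    |(blockForm (fun h k => L.A h k x) ψ ψ).re| ≤ C * (L.scalarForm x ψ ψ).re := by
  rw [← formQ_eq, ← formA_eq, abs_of_nonneg (hL.A_re_nonneg x ψ)]
  exact hL.A_re_le x ψ

lemma Standing.abs_im_blockForm_A_le (hL : L.Standing c₀ C) (x : EuclideanSpace ℝ (Fin d))
    (ψ : Fin d → EuclideanSpace ℂ (Fin m)) :
    |(blockForm (fun h k => L.A h k x) ψ ψ).im| ≤ C * (L.scalarForm x ψ ψ).re := by
  rw [← formQ_eq, ← formA_eq]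
  exact hL.A_im_le x ψ

/-- Polarization with `α = β = C` costs `C` times the sum of the energies of `θ` and of its radial
part; the latter is at most the former. -/
lemma Standing.abs_re_blockForm_A_radial_le (hL : L.Standing c₀ C) (x : EuclideanSpace ℝ (Fin d))
    (θ : Fin d → EuclideanSpace ℂ (Fin m)) (z : EuclideanSpace ℂ (Fin m))
    (a : EuclideanSpace ℝ (Fin d)) (ha : ∀ h, a h = (pair (θ h) z).re) {s : ℝ} (hs : 0 ≤ s)
    (hsz : s * ‖z‖ ^ 2 ≤ 1) :
    |s * (blockForm (fun h k => L.A h k x) θ fun h => (a h : ℂ) • z).re|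
      ≤ 2 * C * (L.scalarForm x θ θ).re := by
  have h := abs_re_le_of_diagonal _ _ (hL.abs_re_blockForm_A_le x) (hL.abs_im_blockForm_A_le x) θ
    ((s : ℂ) • fun h => (a h : ℂ) • z)
  simp only [LinearMap.map_smulₛₗ, LinearMap.smul_apply, smul_eq_mul, Complex.conj_ofReal,
    Complex.re_ofReal_mul, map_smul] at h
  rw [re_scalarForm_smul_smul] at h
  refine h.trans ?_
  have hqa := hL.pair_Q_nonneg x a
  have hrad := hL.mul_pair_le_scalarForm x θ z a ha hs hsz
  have h1 : s * (s * (pair (act (L.Q x) a) a * ‖z‖ ^ 2)) ≤ s * pair (act (L.Q x) a) a := by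
    nlinarith [mul_nonneg (mul_nonneg hs hqa) (sub_nonneg.2 hsz)]
  have h2 := mul_le_mul_of_nonneg_left (h1.trans hrad) hL.C_pos.le
  linarith

/-- Coercivity of the principal part tested with `θ` plus `p - 2` times its radial part. -/
lemma Standing.Theta_mul_le (hL : L.Standing c₀ C) (x : EuclideanSpace ℝ (Fin d))
    (θ : Fin d → EuclideanSpace ℂ (Fin m)) (z : EuclideanSpace ℂ (Fin m))
    (a : EuclideanSpace ℝ (Fin d)) (ha : ∀ h, a h = (pair (θ h) z).re) {s : ℝ} (hs : 0 ≤ s)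
    (hsz : s * ‖z‖ ^ 2 ≤ 1) {p : ℝ} (hp : 1 ≤ p) :
    Theta p C * (L.scalarForm x θ θ).re ≤ (blockForm (fun h k => L.block h k x) θ θ).re
      + (p - 2) * (s * (blockForm (fun h k => L.block h k x) θ fun h => (a h : ℂ) • z).re) := by
  rw [blockForm_block, blockForm_block, Complex.add_re, Complex.add_re,
    re_scalarForm_right_smul x θ z a ha, mul_add s]
  obtain ⟨h1, h2⟩ := abs_le.1 (hL.abs_re_blockForm_A_radial_le x θ z a ha hs hsz)
  have hrad := hL.mul_pair_le_scalarForm x θ z a ha hs hsz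
  have hAθ : 0 ≤ (blockForm (fun h k => L.A h k x) θ θ).re := hL.A_re_nonneg x θ
  have hN := hL.scalarForm_nonneg x θ
  have hCN := mul_nonneg hL.C_pos.le hN
  have hsq := mul_nonneg hs (hL.pair_Q_nonneg x a)
  generalize s * (blockForm (fun h k => L.A h k x) θ fun h => (a h : ℂ) • z).re = b at *
  generalize (blockForm (fun h k => L.A h k x) θ θ).re = a₀ at *
  generalize (L.scalarForm x θ θ).re = N at *
  generalize s * pair (act (L.Q x) a) a = y at *
  -- Here `0 ≤ y ≤ N`, `|b| ≤ 2CN` and `a₀ ≥ 0`. For `p < 2` use `y ≤ N`, for `p ≥ 2` use `y ≥ 0`.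
  -- The coefficients `5 - 2p` and `2p - 3` in `Theta` exceed or equal the `|p - 2|` that is needed.
  rw [Theta]
  split_ifs with h
  · nlinarith
  · nlinarith

/-- Cauchy–Schwarz for the full principal part, with diagonal constants `1 + C` (real) and `c₀ + C`
(imaginary); their sum is the factor appearing in `Lambda`. -/
lemma Standing.sq_re_blockForm_le (hL : L.Standing c₀ C) (x : EuclideanSpace ℝ (Fin d))
    (θ : Fin d → EuclideanSpace ℂ (Fin m)) (z : EuclideanSpace ℂ (Fin m))
    (g : EuclideanSpace ℝ (Fin d)) :
    (blockForm (fun h k => L.block h k x) θ fun h => (g h : ℂ) • z).re ^ 2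
      ≤ (1 + c₀ + 2 * C) ^ 2
        * ((L.scalarForm x θ θ).re * (pair (act (L.Q x) g) g * ‖z‖ ^ 2)) := by
  have hBre : ∀ ψ, |(blockForm (fun h k => L.block h k x) ψ ψ).re|
      ≤ (1 + C) * (L.scalarForm x ψ ψ).re := fun ψ => by
    rw [blockForm_block, Complex.add_re]
    refine (abs_add_le _ _).trans ?_
    rw [abs_of_nonneg (hL.scalarForm_nonneg x ψ)]
    linarith [hL.abs_re_blockForm_A_le x ψ]
  have hBim : ∀ ψ, |(blockForm (fun h k => L.block h k x) ψ ψ).im|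
      ≤ (c₀ + C) * (L.scalarForm x ψ ψ).re := fun ψ => by
    rw [blockForm_block, Complex.add_im]
    refine (abs_add_le _ _).trans ?_
    linarith [hL.abs_im_blockForm_A_le x ψ, hL.abs_im_scalarForm_le x ψ]
  have h := sq_re_le_of_diagonal _ _ hBre hBim θ fun h => (g h : ℂ) • z
  rw [re_scalarForm_smul_smul] at h
  rwa [show 1 + C + (c₀ + C) = 1 + c₀ + 2 * C by ring] at h

lemma sum_pair_block_eq (x : EuclideanSpace ℝ (Fin d))
    (g a : EuclideanSpace ℝ (Fin d)) (θ : Fin d → EuclideanSpace ℂ (Fin m))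
    (z : EuclideanSpace ℂ (Fin m)) (c₁ c₂ s : ℝ) :
    (∑ h, pair (∑ k, act (L.block h k x) (θ k))
          (θ h + ((c₁ * g h + c₂ * (s * a h) : ℝ) : ℂ) • z)).re
      = (blockForm (fun h k => L.block h k x) θ θ).re
        + c₁ * (blockForm (fun h k => L.block h k x) θ fun h => (g h : ℂ) • z).re
        + c₂ * (s * (blockForm (fun h k => L.block h k x) θ fun h => (a h : ℂ) • z).re) := by
  have hsum : ∑ h, pair (∑ k, act (L.block h k x) (θ k))
          (θ h + ((c₁ * g h + c₂ * (s * a h) : ℝ) : ℂ) • z)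
      = blockForm (fun h k => L.block h k x) θ (θ + (c₁ : ℂ) • (fun h => (g h : ℂ) • z)
          + (c₂ : ℂ) • ((s : ℂ) • fun h => (a h : ℂ) • z)) := by
    rw [blockForm_apply]
    refine Finset.sum_congr rfl fun h _ => ?_
    refine (inner_sum _ _ _).trans (Finset.sum_congr rfl fun k _ => ?_)
    rw [pair]
    congr 1
    simp only [Pi.add_apply, Pi.smul_apply, smul_smul, add_assoc, mul_assoc, ← add_smul]
    push_cast
    rfl
  rw [hsum]
  simp only [map_add, LinearMap.map_smulₛₗ, smul_eq_mul, Complex.conj_ofReal,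
    Complex.re_ofReal_mul, Complex.add_re]

/-- The algebraic core, with `r`, `g`, `θ`, `z` in the roles of `v`, `∇v`, `(D_h u)_h`, `u`. The
cubic bound on `g` offsets the factor `1/r²` from `((p-1)/r)²` and leaves one power of `r`, matching
`V`. -/
lemma Standing.pointwise_bound (hL : L.Standing c₀ C) (x : EuclideanSpace ℝ (Fin d)) {r : ℝ}
    (hr : 0 < r) (hV : ∀ ξ : EuclideanSpace ℝ (Fin m), r * ‖ξ‖ ^ 2 ≤ pair (act (L.V x) ξ) ξ)
    (g : EuclideanSpace ℝ (Fin d)) {κ : ℝ} (hg : pair (act (L.Q x) g) g ≤ κ ^ 2 * r ^ 3) {p : ℝ}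
    (hΘ : 0 < Theta p C) (θ : Fin d → EuclideanSpace ℂ (Fin m)) (z : EuclideanSpace ℂ (Fin m))
    {s : ℝ} (hs : 0 ≤ s) (hsz : s * ‖z‖ ^ 2 ≤ 1) (hp : 1 ≤ p) :
    (1 - (p - 1) ^ 2 * κ ^ 2 * (1 + c₀ + 2 * C) ^ 2 / (4 * Theta p C)) * (r * ‖z‖ ^ 2)
      ≤ (∑ h, pair (∑ k, act (L.block h k x) (θ k))
          (θ h + (((p - 1) / r * g h + (p - 2) * (s * (pair (θ h) z).re) : ℝ) : ℂ) • z)).re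
        + (pair (act (L.V x) z) z).re := by
  obtain ⟨a, ha⟩ : ∃ a : EuclideanSpace ℝ (Fin d), ∀ h, a h = (pair (θ h) z).re :=
    ⟨WithLp.toLp 2 fun h => (pair (θ h) z).re, fun h => rfl⟩
  have hVz := re_pair_V_ge x hV z
  have hsum := sum_pair_block_eq (L := L) x g a θ z ((p - 1) / r) (p - 2) s
  simp only [ha] at hsum
  rw [hsum]
  have hmain := hL.Theta_mul_le x θ z a ha hs hsz hp
  simp only [ha] at hmain
  have hcross := hL.sq_re_blockForm_le x θ z g
  have hN := hL.scalarForm_nonneg x θ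
  generalize (blockForm (fun h k => L.block h k x) θ fun h => (g h : ℂ) • z).re = b at *
  generalize (L.scalarForm x θ θ).re = N at *
  generalize Theta p C = Θ at *
  generalize 1 + c₀ + 2 * C = M at *
  have hY0 : 0 ≤ r * ‖z‖ ^ 2 := by positivity
  obtain ⟨δ, hδ⟩ : ∃ δ, δ = (p - 1) ^ 2 * κ ^ 2 * M ^ 2 / (4 * Θ) := ⟨_, rfl⟩
  have hδ0 : 0 ≤ δ := by rw [hδ]; positivity
  rw [← hδ]
  -- `δ` is chosen so that the Cauchy–Schwarz bound is exactly `4XY` with `X = ΘN`, `Y = δ r|z|²`;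
  -- then `4XY ≤ (X + Y)²`.
  have hb2 : ((p - 1) / r * b) ^ 2 ≤ (Θ * N + δ * (r * ‖z‖ ^ 2)) ^ 2 := by
    have h1 : b ^ 2 ≤ M ^ 2 * (N * (κ ^ 2 * r ^ 3 * ‖z‖ ^ 2)) := hcross.trans (by gcongr)
    calc ((p - 1) / r * b) ^ 2 = ((p - 1) / r) ^ 2 * b ^ 2 := by ring
      _ ≤ ((p - 1) / r) ^ 2 * (M ^ 2 * (N * (κ ^ 2 * r ^ 3 * ‖z‖ ^ 2))) := by gcongr
      _ = 4 * (Θ * N) * (δ * (r * ‖z‖ ^ 2)) := by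
        rw [hδ]
        field_simp
      _ ≤ (Θ * N + δ * (r * ‖z‖ ^ 2)) ^ 2 := by
        nlinarith [sq_nonneg (Θ * N - δ * (r * ‖z‖ ^ 2))]
  have hb := (abs_le.1 (abs_le_of_sq_le_sq hb2 (by positivity))).1
  linarith

end Coefficients

/-- The endpoints of the interval are the zeros of the two affine branches of `Theta`. -/
lemma Theta_pos {p C : ℝ} (hC : 0 < C)
    (hp : p ∈ Set.Ioo (1 + 6 * C / (4 * C + 1)) (3 / 2 + 1 / (4 * C))) : 0 < Theta p C := by
  obtain ⟨h1, h2⟩ := hp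
  rw [Theta]
  split_ifs
  · have : 6 * C / (4 * C + 1) < p - 1 := by linarith
    rw [div_lt_iff₀ (by positivity)] at this
    linarith
  · have : p - 3 / 2 < 1 / (4 * C) := by linarith
    rw [lt_div_iff₀ (by positivity)] at this
    linarith

end Forms

end EllipticSystem

namespace EllipticSystem

open MeasureTheory

/-! ### The test function, integration by parts and the energy inequality. -/

section Calculus

variable {d m : ℕ}

lemma real_inner_eq_re_pair (a b : EuclideanSpace ℂ (Fin m)) : inner ℝ b a = (pair a b).re := by
  simp [pair_eq_sum, PiLp.inner_apply, Complex.inner]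

/-- The regularized weight `v^{p-1} (|u|² + ε)^{(p-2)/2}` of the test function. -/
noncomputable def weight (v : EuclideanSpace ℝ (Fin d) → ℝ)
    (u : EuclideanSpace ℝ (Fin d) → EuclideanSpace ℂ (Fin m)) (p ε : ℝ)
    (x : EuclideanSpace ℝ (Fin d)) : ℝ :=
  v x ^ (p - 1) * (‖u x‖ ^ 2 + ε) ^ ((p - 2) / 2)

variable {v : EuclideanSpace ℝ (Fin d) → ℝ}
  {u : EuclideanSpace ℝ (Fin d) → EuclideanSpace ℂ (Fin m)} {p ε : ℝ}

lemma weight_nonneg (hv : ∀ x, 0 < v x) (hε : 0 < ε) (x : EuclideanSpace ℝ (Fin d)) :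
    0 ≤ weight v u p ε x := by
  have := hv x
  unfold weight
  positivity

lemma contDiff_weight (hv : ContDiff ℝ 1 v) (hv0 : ∀ x, 0 < v x) (hu : ContDiff ℝ 1 u)
    (hε : 0 < ε) : ContDiff ℝ 1 (weight v u p ε) := by
  unfold weight
  refine (hv.rpow_const_of_ne fun x => (hv0 x).ne').mul
    (((hu.norm_sq ℝ).add contDiff_const).rpow_const_of_ne fun x => ?_)
  positivity

lemma fderiv_weight (hv : ContDiff ℝ 1 v) (hv0 : ∀ x, 0 < v x) (hu : ContDiff ℝ 1 u)
    (hε : 0 < ε) (x e : EuclideanSpace ℝ (Fin d)) :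
    fderiv ℝ (weight v u p ε) x e = weight v u p ε x * ((p - 1) / v x * fderiv ℝ v x e
      + (p - 2) * ((‖u x‖ ^ 2 + ε)⁻¹ * inner ℝ (u x) (fderiv ℝ u x e))) := by
  have hpos : 0 < ‖u x‖ ^ 2 + ε := by positivity
  have h1 := ((hv.differentiable one_ne_zero x).hasFDerivAt).rpow_const (p := p - 1)
    (Or.inl (hv0 x).ne')
  have h2 := ((((hu.differentiable one_ne_zero x).hasFDerivAt).norm_sq).add_const ε).rpow_const
    (p := (p - 2) / 2) (Or.inl hpos.ne')
  have h3 : HasFDerivAt (weight v u p ε) _ x := h1.mul h2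
  rw [h3.fderiv]
  simp only [add_apply, smul_apply, smul_eq_mul,
    ContinuousLinearMap.comp_apply, innerSL_apply_apply, Real.rpow_sub_one (hv0 x).ne',
    Real.rpow_sub_one hpos.ne', nsmul_eq_mul, weight]
  push_cast
  ring

lemma fderiv_weight_smul (hv : ContDiff ℝ 1 v) (hv0 : ∀ x, 0 < v x) (hu : ContDiff ℝ 1 u)
    (hε : 0 < ε) (x : EuclideanSpace ℝ (Fin d)) (h : Fin d) :
    fderiv ℝ (fun y => weight v u p ε y • u y) x (EuclideanSpace.single h 1)
      = weight v u p ε x • (partialD h u x + (((p - 1) / v x * gradient v x h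
        + (p - 2) * ((‖u x‖ ^ 2 + ε)⁻¹ * (pair (partialD h u x) (u x)).re) : ℝ) : ℂ) • u x) := by
  have hρ := (contDiff_weight (p := p) hv hv0 hu hε).differentiable one_ne_zero x
  have hg : gradient v x h = fderiv ℝ v x (EuclideanSpace.single h 1) := by
    rw [← inner_gradient_left]
    simpa using (EuclideanSpace.inner_single_right h (1 : ℝ) (gradient v x)).symm
  rw [fderiv_fun_smul hρ (hu.differentiable one_ne_zero x)]
  simp only [add_apply, smul_apply,
    ContinuousLinearMap.smulRight_apply]
  rw [fderiv_weight hv hv0 hu hε, hg, ← real_inner_eq_re_pair, smul_add, partialD, mul_smul]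
  congr 2

namespace Coefficients

variable {L : Coefficients d m} {c₀ C : ℝ}

/-- The flux `∑_k Q^{hk} D_k u`. -/
noncomputable def flux (L : Coefficients d m)
    (u : EuclideanSpace ℝ (Fin d) → EuclideanSpace ℂ (Fin m)) (h : Fin d)
    (x : EuclideanSpace ℝ (Fin d)) : EuclideanSpace ℂ (Fin m) :=
  ∑ k, act (L.block h k x) (partialD k u x)

lemma contDiff_partialD (hu : ContDiff ℝ ∞ u) (k : Fin d) : ContDiff ℝ ∞ (partialD k u) :=
  (hu.fderiv_right (m := ∞) le_rfl).clm_apply contDiff_const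

lemma hasCompactSupport_partialD (hc : HasCompactSupport u) (k : Fin d) :
    HasCompactSupport (partialD k u) :=
  hc.fderiv_apply ℝ _

lemma Standing.contDiff_act_block (hL : L.Standing c₀ C) (hu : ContDiff ℝ ∞ u) (h k : Fin d) :
    ContDiff ℝ 1 fun x => act (L.block h k x) (partialD k u x) := by
  rw [contDiff_piLp]
  intro i
  simp only [act_apply]
  refine ContDiff.sum fun j _ => ContDiff.mul ?_ ?_
  · refine Complex.ofRealCLM.contDiff.comp ?_
    simp only [block, Matrix.add_apply, Matrix.smul_apply, smul_eq_mul]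
    exact ((hL.q_contDiff h k).mul contDiff_const).add (hL.A_contDiff h k i j)
  · exact (contDiff_piLp 2).1 ((contDiff_partialD hu k).of_le (by simp)) j

lemma Standing.contDiff_flux (hL : L.Standing c₀ C) (hu : ContDiff ℝ ∞ u) (h : Fin d) :
    ContDiff ℝ 1 (L.flux u h) :=
  ContDiff.sum fun k _ => hL.contDiff_act_block hu h k

lemma hasCompactSupport_flux (hc : HasCompactSupport u) (h : Fin d) :
    HasCompactSupport (L.flux u h) := by
  refine (hc.fderiv (𝕜 := ℝ)).mono fun x hx => ?_
  contrapose! hx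
  simp only [Function.mem_support, not_not] at hx ⊢
  refine Finset.sum_eq_zero fun k _ => ?_
  ext i
  simp [partialD, hx, act_apply]

lemma Standing.op_eq (hL : L.Standing c₀ C) (hu : ContDiff ℝ ∞ u) (x : EuclideanSpace ℝ (Fin d)) :
    L.op u x = (∑ h, partialD h (L.flux u h) x) - act (L.V x) (u x) := by
  rw [op]
  congr 1
  refine Finset.sum_congr rfl fun h _ => ?_
  have h1 : fderiv ℝ (L.flux u h) x = _ := fderiv_fun_sum fun k _ =>
    (hL.contDiff_act_block hu h k).differentiable one_ne_zero x
  rw [partialD, h1, sum_apply]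
  rfl

/-- The entries of `V` are only locally bounded, so each is cut off to the support of `u`, where it
is in `L^∞`, and multiplied by a continuous compactly supported factor. -/
lemma Standing.memLp_act_V (hL : L.Standing c₀ C) (hu : Continuous u) (hc : HasCompactSupport u)
    (r : ENNReal) : MemLp (fun x => act (L.V x) (u x)) r volume := by
  have hent : ∀ i j, MemLp (fun x => (tsupport u).indicator (fun y => L.V y i j) x •
      (EuclideanSpace.single i (u x j) : EuclideanSpace ℂ (Fin m))) r volume := fun i j => by
    have h1 : MemLp ((tsupport u).indicator fun x => L.V x i j) ⊤ volume :=
      (memLp_indicator_iff_restrict (isClosed_tsupport u).measurableSet).2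
        (hL.V_locBounded i j _ hc)
    have h2 : MemLp (fun x => (EuclideanSpace.single i (u x j) : EuclideanSpace ℂ (Fin m))) r
        volume := by
      refine Continuous.memLp_of_hasCompactSupport ?_ (hc.mono fun x hx => ?_)
      · refine (PiLp.continuous_toLp 2 _).comp ?_
        have : Continuous fun x => u x j := by fun_prop
        exact (continuous_single i).comp this
      · contrapose! hx
        simp only [Function.mem_support, not_not] at hx ⊢
        simp [hx]
    exact h2.smul h1
  have key : (fun x => act (L.V x) (u x)) = fun x => ∑ i, ∑ j,
      (tsupport u).indicator (fun y => L.V y i j) x •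
        (EuclideanSpace.single i (u x j) : EuclideanSpace ℂ (Fin m)) := by
    funext x
    ext i
    simp only [act_apply, WithLp.ofLp_sum, Finset.sum_apply, PiLp.smul_apply, PiLp.single_apply]
    symm
    refine (Finset.sum_eq_single i (fun b _ hb => by simp [Ne.symm hb]) (by simp)).trans ?_
    symm
    refine Finset.sum_congr rfl fun j _ => ?_
    by_cases hx : x ∈ tsupport u
    · simp [hx]
    · simp [image_eq_zero_of_notMem_tsupport hx]
  rw [key]
  exact memLp_finsetSum _ fun i _ => memLp_finsetSum _ fun j _ => hent i j

lemma Standing.memLp_op (hL : L.Standing c₀ C) (hu : ContDiff ℝ ∞ u) (hc : HasCompactSupport u)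
    (r : ENNReal) : MemLp (L.op u) r volume := by
  have hflux : ∀ h, MemLp (fun x => partialD h (L.flux u h) x) r volume := fun h =>
    Continuous.memLp_of_hasCompactSupport
      (((hL.contDiff_flux hu h).continuous_fderiv one_ne_zero).clm_apply continuous_const)
      (hasCompactSupport_partialD (hasCompactSupport_flux hc h) h)
  have hsum : MemLp (fun x => ∑ h, partialD h (L.flux u h) x) r volume :=
    memLp_finsetSum _ fun h _ => hflux h
  exact (memLp_congr_ae (ae_of_all _ fun x => hL.op_eq hu x)).2
    (hsum.sub (hL.memLp_act_V hu.continuous hc r))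

end Coefficients

/-- Integration by parts for a compactly supported field. -/
lemma integral_inner_partialD_add {F φ : EuclideanSpace ℝ (Fin d) → EuclideanSpace ℂ (Fin m)}
    (hF : ContDiff ℝ 1 F) (hFc : HasCompactSupport F) (hφ : ContDiff ℝ 1 φ) (h : Fin d) :
    Integrable (fun x => (inner ℝ (F x) (partialD h φ x) + inner ℝ (partialD h F x) (φ x) : ℝ)) ∧
      ∫ x, (inner ℝ (F x) (partialD h φ x) + inner ℝ (partialD h F x) (φ x) : ℝ) = 0 := by
  have hmono : ∀ {G H : EuclideanSpace ℝ (Fin d) → EuclideanSpace ℂ (Fin m)},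
      Continuous G → Continuous H → HasCompactSupport G →
      Integrable fun x => (inner ℝ (G x) (H x) : ℝ) := fun hG hH hGc =>
    Continuous.integrable_of_hasCompactSupport (hG.inner hH) (hGc.mono fun x hx => by
      contrapose! hx
      simp only [Function.mem_support, not_not] at hx ⊢
      simp [hx])
  have hdF : Continuous (partialD h F) :=
    (hF.continuous_fderiv one_ne_zero).clm_apply continuous_const
  have hdφ : Continuous (partialD h φ) :=
    (hφ.continuous_fderiv one_ne_zero).clm_apply continuous_const
  have h1 := hmono hF.continuous hdφ hFc
  have h2 := hmono hdF hφ.continuous (Coefficients.hasCompactSupport_partialD hFc h)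
  refine ⟨h1.add h2, ?_⟩
  rw [integral_add h1 h2]
  have hparts : ∫ x, (inner ℝ (F x) (partialD h φ x) : ℝ)
      = -∫ x, (inner ℝ (partialD h F x) (φ x) : ℝ) := integral_bilinear_fderiv_right_eq_neg_left_of_integrable (μ := volume)
    (B := innerSL ℝ) (f := F) (g := φ) (v := EuclideanSpace.single h (1 : ℝ))
    h2 h1 (hmono hF.continuous hφ.continuous hFc)
    (fun x _ => hF.differentiable one_ne_zero x)
    (fun x _ => hφ.differentiable one_ne_zero x)
  rw [hparts, neg_add_cancel]

namespace Coefficients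

variable {L : Coefficients d m} {c₀ C : ℝ}

/-- The algebraic bound taken at `s = (|u|² + ε)⁻¹`, with `V u` replaced by the divergence of the
flux minus `L.op u`. The sum over `h` is kept whole because it integrates to zero. -/
lemma Standing.weight_pointwise_le (hL : L.Standing c₀ C) (hv : ContDiff ℝ 1 v)
    (hv0 : ∀ x, 0 < v x) (hu : ContDiff ℝ ∞ u) (hε : 0 < ε) {c : ℝ}
    (x : EuclideanSpace ℝ (Fin d))
    (hbound : ∀ (θ : Fin d → EuclideanSpace ℂ (Fin m)) (z : EuclideanSpace ℂ (Fin m)) (s : ℝ),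
      0 ≤ s → s * ‖z‖ ^ 2 ≤ 1 →
      c * (v x * ‖z‖ ^ 2) ≤ (∑ h, pair (∑ k, act (L.block h k x) (θ k))
          (θ h + (((p - 1) / v x * gradient v x h + (p - 2) * (s * (pair (θ h) z).re) : ℝ) : ℂ)
            • z)).re + (pair (act (L.V x) z) z).re) :
    c * (v x * ‖u x‖ ^ 2 * weight v u p ε x) ≤ ‖L.op u x‖ * (‖u x‖ * weight v u p ε x)
      + ∑ h, (inner ℝ (L.flux u h x) (partialD h (fun y => weight v u p ε y • u y) x)
        + inner ℝ (partialD h (L.flux u h) x) (weight v u p ε x • u x)) := by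
  have hu1 : ContDiff ℝ 1 u := hu.of_le (by simp)
  have hρx : 0 ≤ weight v u p ε x := weight_nonneg hv0 hε x
  have hb := hbound (fun k => partialD k u x) (u x) (‖u x‖ ^ 2 + ε)⁻¹ (by positivity) (by
    rw [inv_mul_le_iff₀ (by positivity)]
    linarith)
  have hdφ : ∀ h, partialD h (fun y => weight v u p ε y • u y) x = _ := fun h =>
    fderiv_weight_smul (p := p) hv hv0 hu1 hε x h
  simp only [hdφ, inner_smul_right]
  generalize weight v u p ε x = ρ at *
  have h1 : ∑ h, ρ * (inner ℝ (partialD h (L.flux u h) x) (u x) : ℝ)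
      = ρ * inner ℝ (L.op u x) (u x) + ρ * inner ℝ (act (L.V x) (u x)) (u x) := by
    rw [hL.op_eq hu, ← mul_add, ← inner_add_left, sub_add_cancel, ← Finset.mul_sum, sum_inner]
  have h3 : -(‖L.op u x‖ * (‖u x‖ * ρ)) ≤ ρ * inner ℝ (L.op u x) (u x) := by
    have h := (abs_le.1 (abs_real_inner_le_norm (L.op u x) (u x))).1
    nlinarith
  have h4 := mul_le_mul_of_nonneg_left hb hρx
  simp only [Complex.re_sum, ← real_inner_eq_re_pair] at h4 ⊢
  rw [Finset.sum_add_distrib, h1, ← Finset.mul_sum]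
  simp only [real_inner_comm (u x) (act (L.V x) (u x))] at h4 ⊢
  have h5 : ∀ h, (inner ℝ (L.flux u h x) (partialD h u x + (((p - 1) / v x * gradient v x h
      + (p - 2) * ((‖u x‖ ^ 2 + ε)⁻¹ * inner ℝ (u x) (partialD h u x)) : ℝ) : ℂ) • u x) : ℝ)
      = inner ℝ (partialD h u x + (((p - 1) / v x * gradient v x h
      + (p - 2) * ((‖u x‖ ^ 2 + ε)⁻¹ * inner ℝ (u x) (partialD h u x)) : ℝ) : ℂ) • u x)
        (∑ k, act (L.block h k x) (partialD k u x)) := fun h => real_inner_comm _ _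
  simp only [h5]
  linarith

/-- The energy estimate obtained by testing the equation with the regularized function. -/
lemma Standing.integral_weight_le (hL : L.Standing c₀ C) (hv : ContDiff ℝ 1 v)
    (hv0 : ∀ x, 0 < v x) (hu : ContDiff ℝ ∞ u) (hc : HasCompactSupport u) (hε : 0 < ε) {c : ℝ}
    (hbound : ∀ x (θ : Fin d → EuclideanSpace ℂ (Fin m)) (z : EuclideanSpace ℂ (Fin m)) (s : ℝ),
      0 ≤ s → s * ‖z‖ ^ 2 ≤ 1 →
      c * (v x * ‖z‖ ^ 2) ≤ (∑ h, pair (∑ k, act (L.block h k x) (θ k))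
          (θ h + (((p - 1) / v x * gradient v x h + (p - 2) * (s * (pair (θ h) z).re) : ℝ) : ℂ)
            • z)).re + (pair (act (L.V x) z) z).re) :
    c * ∫ x, v x * ‖u x‖ ^ 2 * weight v u p ε x
      ≤ ∫ x, ‖L.op u x‖ * (‖u x‖ * weight v u p ε x) := by
  have hu1 : ContDiff ℝ 1 u := hu.of_le (by simp)
  have hρ := contDiff_weight (p := p) hv hv0 hu1 hε
  have hparts := fun h => integral_inner_partialD_add (hL.contDiff_flux hu h)
    (hasCompactSupport_flux hc h) (hρ.smul hu1) h
  have hJ := integrable_finsetSum (μ := volume) Finset.univ fun h _ => (hparts h).1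
  have hzero := integral_finsetSum (μ := volume) Finset.univ fun h _ => (hparts h).1
  rw [Finset.sum_eq_zero fun h _ => (hparts h).2] at hzero
  have hintf : Integrable fun x => ‖L.op u x‖ * (‖u x‖ * weight v u p ε x) := by
    have h1 : MemLp (fun x => ‖L.op u x‖) 1 volume := (hL.memLp_op hu hc 1).norm
    have h2 : MemLp (fun x => ‖u x‖ * weight v u p ε x) ⊤ volume :=
      Continuous.memLp_of_hasCompactSupport (hu.continuous.norm.mul hρ.continuous)
        hc.norm.mul_right
    exact memLp_one_iff_integrable.1 (h2.mul h1)
  have hintl : Integrable fun x => v x * ‖u x‖ ^ 2 * weight v u p ε x := by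
    refine Continuous.integrable_of_hasCompactSupport
      ((hv.continuous.mul (hu.continuous.norm.pow 2)).mul hρ.continuous) (hc.mono fun x hx => ?_)
    contrapose! hx
    simp only [Function.mem_support, not_not] at hx ⊢
    simp [hx]
  -- Adding the vanishing divergence integral to the right side reduces the claim to integrating the
  -- pointwise inequality.
  rw [← integral_const_mul, ← add_zero (∫ x, ‖L.op u x‖ * _), ← hzero, ← integral_add hintf hJ]
  exact integral_mono (hintl.const_mul c) (hintf.add hJ) fun x =>
    hL.weight_pointwise_le hv hv0 hu hε x (hbound x)

end Coefficients

end Calculus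

end EllipticSystem

namespace EllipticSystem

open MeasureTheory

/-! ### Removing the regularization. -/

section Limit

open Filter Topology

/-- For `p < 2` the power alone blows up as `t, ε → 0`; the factor `t ≤ (t² + ε)^(1/2)` makes the
exponent positive, giving a majorant uniform in `ε`. -/
lemma mul_rpow_sq_add_le {p t T ε : ℝ} (hp : 1 < p) (ht : 0 ≤ t) (htT : t ≤ T) (hε : 0 < ε)
    (hε1 : ε ≤ 1) : t * (t ^ 2 + ε) ^ ((p - 2) / 2) ≤ (T ^ 2 + 1) ^ ((p - 1) / 2) := by
  have hpos : 0 < t ^ 2 + ε := by positivity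
  calc t * (t ^ 2 + ε) ^ ((p - 2) / 2)
      ≤ (t ^ 2 + ε) ^ (1 / 2 : ℝ) * (t ^ 2 + ε) ^ ((p - 2) / 2) := by
        gcongr
        rw [← Real.sqrt_eq_rpow]
        exact Real.le_sqrt_of_sq_le (by linarith)
    _ = (t ^ 2 + ε) ^ ((p - 1) / 2) := by
        rw [← Real.rpow_add hpos]
        congr 1
        ring
    _ ≤ (T ^ 2 + 1) ^ ((p - 1) / 2) := by
        refine Real.rpow_le_rpow hpos.le ?_ (by linarith)
        gcongr

lemma tendsto_mul_rpow_sq_add {p t : ℝ} (hp : 1 < p) (ht : 0 ≤ t) {ε : ℕ → ℝ}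
    (hε : Tendsto ε atTop (𝓝 0)) :
    Tendsto (fun n => t * (t ^ 2 + ε n) ^ ((p - 2) / 2)) atTop (𝓝 (t ^ (p - 1))) := by
  rcases ht.eq_or_lt with rfl | ht
  · simp [Real.zero_rpow (sub_pos.2 hp).ne']
  · have h1 : Tendsto (fun n => t ^ 2 + ε n) atTop (𝓝 (t ^ 2)) := by
      simpa using hε.const_add (t ^ 2)
    have h2 := (h1.rpow_const (p := (p - 2) / 2) (Or.inl (by positivity))).const_mul t
    have h3 : t * (t ^ 2) ^ ((p - 2) / 2) = t ^ (p - 1) := by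
      rw [← Real.rpow_natCast, ← Real.rpow_mul ht.le]
      nth_rw 1 [← Real.rpow_one t]
      rw [← Real.rpow_add ht]
      congr 1
      push_cast
      ring
    rwa [h3] at h2

variable {d m : ℕ} {v : EuclideanSpace ℝ (Fin d) → ℝ}
  {u : EuclideanSpace ℝ (Fin d) → EuclideanSpace ℂ (Fin m)} {p : ℝ}

lemma exists_norm_mul_weight_le (hp : 1 < p) (hv : ContDiff ℝ 1 v) (hv0 : ∀ x, 0 < v x)
    (hu : Continuous u) (hc : HasCompactSupport u) :
    ∃ B, ∀ ε, 0 < ε → ε ≤ 1 → ∀ x, ‖u x‖ * weight v u p ε x ≤ B := by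
  obtain ⟨B, hB⟩ := IsCompact.exists_bound_of_continuousOn (s := tsupport u) hc
    (f := fun x => v x ^ (p - 1) * (‖u x‖ ^ 2 + 1) ^ ((p - 1) / 2))
    (((hv.continuous.rpow_const fun x => Or.inl (hv0 x).ne').mul
      (((hu.norm.pow 2).add continuous_const).rpow_const fun x =>
        Or.inl (by dsimp only [Pi.add_apply, Pi.pow_apply]; positivity))).continuousOn)
  -- Off the support the product is `0`, and `B` could be negative if the support is empty.
  refine ⟨max B 0, fun ε hε hε1 x => ?_⟩
  by_cases hx : x ∈ tsupport u
  · have h1 := mul_rpow_sq_add_le hp (norm_nonneg (u x)) le_rfl hε hε1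
    have h2 : 0 ≤ v x ^ (p - 1) := (Real.rpow_pos_of_pos (hv0 x) _).le
    calc ‖u x‖ * weight v u p ε x
        = v x ^ (p - 1) * (‖u x‖ * (‖u x‖ ^ 2 + ε) ^ ((p - 2) / 2)) := by rw [weight]; ring
      _ ≤ v x ^ (p - 1) * (‖u x‖ ^ 2 + 1) ^ ((p - 1) / 2) := by gcongr
      _ ≤ B := (le_abs_self _).trans (hB x hx)
      _ ≤ max B 0 := le_max_left _ _
  · simp [image_eq_zero_of_notMem_tsupport hx]

lemma tendsto_integral_mul_weight (hp : 1 < p) (hv : ContDiff ℝ 1 v) (hv0 : ∀ x, 0 < v x)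
    (hu : ContDiff ℝ ∞ u) (hc : HasCompactSupport u) {g : EuclideanSpace ℝ (Fin d) → ℝ}
    (hg : Integrable g) :
    Tendsto (fun n : ℕ => ∫ x, g x * (‖u x‖ * weight v u p (1 / ((n : ℝ) + 1)) x)) atTop
      (𝓝 (∫ x, g x * (v x * ‖u x‖) ^ (p - 1))) := by
  obtain ⟨B, hB⟩ := exists_norm_mul_weight_le hp hv hv0 hu.continuous hc
  refine tendsto_integral_of_dominated_convergence (fun x => ‖g x‖ * B) (fun n => ?_)
    (hg.norm.mul_const B) (fun n => ae_of_all _ fun x => ?_) (ae_of_all _ fun x => ?_)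
  · refine hg.aestronglyMeasurable.mul (Continuous.aestronglyMeasurable ?_)
    exact hu.continuous.norm.mul
      (contDiff_weight hv hv0 (hu.of_le (by simp)) Nat.one_div_pos_of_nat).continuous
  · rw [norm_mul]
    gcongr
    rw [Real.norm_of_nonneg (mul_nonneg (norm_nonneg _)
      (weight_nonneg hv0 Nat.one_div_pos_of_nat x))]
    refine hB _ Nat.one_div_pos_of_nat ?_ x
    rw [div_le_one (by positivity)]
    linarith [Nat.cast_nonneg (α := ℝ) n]
  · have h := (tendsto_mul_rpow_sq_add hp (norm_nonneg (u x))
      tendsto_one_div_add_atTop_nhds_zero_nat).const_mul (v x ^ (p - 1))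
    rw [Real.mul_rpow (hv0 x).le (norm_nonneg _)]
    refine Tendsto.const_mul _ (h.congr fun n => ?_)
    rw [weight]
    ring

/-- Absorbing a power of the left-hand side. -/
lemma mul_rpow_le_of_mul_le {p q c F I : ℝ} (hpq : p.HolderConjugate q) (hI : 0 ≤ I) (hF : 0 ≤ F)
    (h : c * I ≤ F * I ^ (1 / q)) : c * I ^ (1 / p) ≤ F := by
  rcases hI.eq_or_lt with rfl | hI
  · simpa [Real.zero_rpow (inv_ne_zero hpq.ne_zero)] using hF
  · have h1 : I = I ^ (1 / p) * I ^ (1 / q) := by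
      rw [← Real.rpow_add hI, one_div, one_div, hpq.inv_add_inv_eq_one, Real.rpow_one]
    refine le_of_mul_le_mul_right ?_ (Real.rpow_pos_of_pos hI (1 / q))
    rwa [mul_assoc, ← h1]

end Limit

/-! ### Hölder's inequality and the constant. -/

section Estimate

variable {d m : ℕ} {L : Coefficients d m} {c₀ C : ℝ} {v : EuclideanSpace ℝ (Fin d) → ℝ}
  {u : EuclideanSpace ℝ (Fin d) → EuclideanSpace ℂ (Fin m)} {p : ℝ}

/-- The limit `ε → 0` is taken on both sides, with `g = v|u|` on the left and `g = |L.op u|` on the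
right. Since `(p-1)p' = p`, Hölder produces `(∫ (v|u|)^p)^(1/p')`, which is absorbed on the left. -/
lemma Coefficients.Standing.eLpNorm_smul_le (hL : L.Standing c₀ C) (hp : 1 < p)
    (hv : ContDiff ℝ 1 v) (hv0 : ∀ x, 0 < v x) (hu : ContDiff ℝ ∞ u) (hc : HasCompactSupport u)
    {c : ℝ} (hcpos : 0 < c)
    (hbound : ∀ x (θ : Fin d → EuclideanSpace ℂ (Fin m)) (z : EuclideanSpace ℂ (Fin m)) (s : ℝ),
      0 ≤ s → s * ‖z‖ ^ 2 ≤ 1 →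
      c * (v x * ‖z‖ ^ 2) ≤ (∑ h, pair (∑ k, act (L.block h k x) (θ k))
          (θ h + (((p - 1) / v x * gradient v x h + (p - 2) * (s * (pair (θ h) z).re) : ℝ) : ℂ)
            • z)).re + (pair (act (L.V x) z) z).re) :
    eLpNorm (fun x => v x • u x) (ENNReal.ofReal p) volume
      ≤ ENNReal.ofReal c⁻¹ * eLpNorm (L.op u) (ENNReal.ofReal p) volume := by
  have hp0 : 0 < p := by linarith
  have hpq := Real.HolderConjugate.conjExponent hp
  have hvu : Continuous fun x => v x * ‖u x‖ := hv.continuous.mul hu.continuous.norm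
  have hvu0 : ∀ x, 0 ≤ v x * ‖u x‖ := fun x => mul_nonneg (hv0 x).le (norm_nonneg _)
  have hvuc : HasCompactSupport fun x => v x * ‖u x‖ := hc.norm.mul_left
  have hf := hL.memLp_op hu hc (ENNReal.ofReal p)
  have hlim : c * ∫ x, v x * ‖u x‖ * (v x * ‖u x‖) ^ (p - 1)
      ≤ ∫ x, ‖L.op u x‖ * (v x * ‖u x‖) ^ (p - 1) := by
    refine le_of_tendsto_of_tendsto' ((tendsto_integral_mul_weight hp hv hv0 hu hc
      (hvu.integrable_of_hasCompactSupport hvuc)).const_mul c)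
      (tendsto_integral_mul_weight hp hv hv0 hu hc
        (memLp_one_iff_integrable.1 (hL.memLp_op hu hc 1).norm)) fun n => ?_
    refine le_trans (le_of_eq ?_)
      (hL.integral_weight_le hv hv0 hu hc Nat.one_div_pos_of_nat hbound)
    congr 2
    funext x
    ring
  have hpow : MemLp (fun x => (v x * ‖u x‖) ^ (p - 1)) (ENNReal.ofReal p.conjExponent) volume :=
    Continuous.memLp_of_hasCompactSupport (hvu.rpow_const fun x => Or.inr (by linarith))
      (hvuc.comp_left (g := fun t : ℝ => t ^ (p - 1)) (Real.zero_rpow (by linarith)))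
  have hholder := integral_mul_le_Lp_mul_Lq_of_nonneg hpq
    (ae_of_all _ fun x => norm_nonneg (L.op u x))
    (ae_of_all _ fun x => Real.rpow_nonneg (hvu0 x) (p - 1)) hf.norm hpow
  have h1 : ∀ x, v x * ‖u x‖ * (v x * ‖u x‖) ^ (p - 1) = (v x * ‖u x‖) ^ p := fun x => by
    rcases (hvu0 x).eq_or_lt with h | h
    · rw [← h, Real.zero_rpow hp0.ne', zero_mul]
    · rw [Real.rpow_sub_one h.ne']
      exact mul_div_cancel₀ _ h.ne'
  have h2 : ∀ x, ((v x * ‖u x‖) ^ (p - 1)) ^ p.conjExponent = (v x * ‖u x‖) ^ p := fun x => by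
    rw [← Real.rpow_mul (hvu0 x), hpq.sub_one_mul_conj]
  simp only [h1, h2] at hlim hholder
  have hfinal := mul_rpow_le_of_mul_le hpq
    (integral_nonneg fun x => Real.rpow_nonneg (hvu0 x) p)
    (Real.rpow_nonneg (integral_nonneg fun x => Real.rpow_nonneg (norm_nonneg _) p) _)
    (hlim.trans hholder)
  have hmem : MemLp (fun x => v x • u x) (ENNReal.ofReal p) volume :=
    (hv.continuous.smul hu.continuous).memLp_of_hasCompactSupport hc.smul_left
  have hp1 : ENNReal.ofReal p ≠ 0 := by simpa using hp0
  rw [hmem.eLpNorm_eq_integral_rpow_norm hp1 ENNReal.ofReal_ne_top,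
    hf.eLpNorm_eq_integral_rpow_norm hp1 ENNReal.ofReal_ne_top,
    ← ENNReal.ofReal_mul (inv_nonneg.2 hcpos.le), ENNReal.toReal_ofReal hp0.le]
  refine ENNReal.ofReal_le_ofReal ?_
  rw [← div_eq_inv_mul, le_div_iff₀' hcpos]
  simp only [norm_smul, Real.norm_of_nonneg (hv0 _).le, ← one_div]
  exact hfinal

/-- The ratio `(γ r^{3/2} + Cγ)² / r³` is nonincreasing in `r`. -/
lemma le_sq_mul_pow_three_of_sqrt_le {y r v₀ γ Cγ : ℝ} (hv₀ : 0 < v₀) (hr : v₀ ≤ r)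
    (hCγ : 0 < Cγ) (hy : 0 ≤ y) (h : Real.sqrt y ≤ γ * r ^ (3 / 2 : ℝ) + Cγ) :
    y ≤ ((γ * v₀ ^ (3 / 2 : ℝ) + Cγ) / v₀ ^ (3 / 2 : ℝ)) ^ 2 * r ^ 3 := by
  have hr0 : 0 < r := hv₀.trans_le hr
  have hle : v₀ ^ (3 / 2 : ℝ) ≤ r ^ (3 / 2 : ℝ) := by gcongr
  have hpos : 0 < v₀ ^ (3 / 2 : ℝ) := by positivity
  have hcube : r ^ 3 = (r ^ (3 / 2 : ℝ)) ^ 2 := by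
    rw [← Real.rpow_natCast (r ^ (3 / 2 : ℝ)), ← Real.rpow_mul hr0.le, ← Real.rpow_natCast]
    norm_num
  rw [hcube, ← mul_pow, ← Real.sq_sqrt hy]
  gcongr
  refine h.trans ?_
  rw [div_mul_eq_mul_div, le_div_iff₀ hpos]
  nlinarith

/-- Puts the constant in the shape of `pointwise_bound`, with `κ = (γ v₀^(3/2) + Cγ) / v₀^(3/2)`. -/
lemma Lambda_eq {p C c₀ γ Cγ v₀ : ℝ} (hv₀ : 0 < v₀) :
    Lambda p C c₀ γ Cγ v₀ = 1 - (p - 1) ^ 2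
      * ((γ * v₀ ^ (3 / 2 : ℝ) + Cγ) / v₀ ^ (3 / 2 : ℝ)) ^ 2 * (1 + c₀ + 2 * C) ^ 2
        / (4 * Theta p C) := by
  have hcube : v₀ ^ 3 = (v₀ ^ (3 / 2 : ℝ)) ^ 2 := by
    rw [← Real.rpow_natCast (v₀ ^ (3 / 2 : ℝ)), ← Real.rpow_mul hv₀.le, ← Real.rpow_natCast]
    norm_num
  rw [Lambda, hcube, div_pow]
  congr 1
  have : v₀ ^ (3 / 2 : ℝ) ≠ 0 := by positivity
  rcases eq_or_ne (Theta p C) 0 with h | h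
  · simp [h]
  · field_simp

end Estimate

end EllipticSystem

theorem proposition4p1 (d m : ℕ) (L : EllipticSystem.Coefficients d m) (c₀ C : ℝ)
    (hL : L.Standing c₀ C)
    (v : EuclideanSpace ℝ (Fin d) → ℝ) (hv : ContDiff ℝ 1 v)
    (v₀ : ℝ) (hinf : IsGLB (Set.range v) v₀) (hv₀ : 0 < v₀)
    (γ Cγ : ℝ) (hγ : 0 < γ) (hCγ : 0 < Cγ)
    (hgrad : ∀ x : EuclideanSpace ℝ (Fin d),
      Real.sqrt (EllipticSystem.pair (EllipticSystem.act (L.Q x) (gradient v x)) (gradient v x))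
        ≤ γ * v x ^ (3 / 2 : ℝ) + Cγ)
    (hV : ∀ (x : EuclideanSpace ℝ (Fin d)) (ξ : EuclideanSpace ℝ (Fin m)),
      v x * ‖ξ‖ ^ 2 ≤ EllipticSystem.pair (EllipticSystem.act (L.V x) ξ) ξ)
    (hC : C < 1 / 2) (p : ℝ)
    (hp : p ∈ Set.Ioo (1 + 6 * C / (4 * C + 1)) (3 / 2 + 1 / (4 * C)))
    (hΛ : 0 < EllipticSystem.Lambda p C c₀ γ Cγ v₀) :
    ∃ K : ℝ, 0 < K ∧
      ∀ u : EuclideanSpace ℝ (Fin d) → EuclideanSpace ℂ (Fin m),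
        ContDiff ℝ ∞ u → HasCompactSupport u →
          MeasureTheory.eLpNorm (fun x => v x • u x) (ENNReal.ofReal p) MeasureTheory.volume
            ≤ ENNReal.ofReal K *
              MeasureTheory.eLpNorm (L.op u) (ENNReal.ofReal p) MeasureTheory.volume := by
  have hv0 : ∀ x, 0 < v x := fun x => hv₀.trans_le (hinf.1 ⟨x, rfl⟩)
  have hp1 : 1 < p := by
    have := hL.C_pos
    have : 0 < 6 * C / (4 * C + 1) := by positivity
    linarith [hp.1]
  rw [EllipticSystem.Lambda_eq hv₀] at hΛ
  refine ⟨_, inv_pos.2 hΛ, fun u hu hc => hL.eLpNorm_smul_le hp1 hv hv0 hu hc hΛ ?_⟩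
  exact fun x θ z s hs hsz => hL.pointwise_bound x (hv0 x) (hV x) (gradient v x)
    (EllipticSystem.le_sq_mul_pow_three_of_sqrt_le hv₀ (hinf.1 ⟨x, rfl⟩) hCγ
      (hL.pair_Q_nonneg x _) (hgrad x))
    (EllipticSystem.Theta_pos hL.C_pos hp) θ z hs hsz hp1.le
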